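/- Let $\mathsf X\subseteq\mathbb R^d$ be open, let $K\subset\mathsf X$ be convex and compact, and let $F:\mathsf X\to\mathcal P(\mathbb R^d)$ be upper hemicontinuous (each $F(x)$ is nonempty and every open set containing $F(x)$ contains $F(z)$ for all $z$ near $x$), with convex compact values and locally bounded ($\bigcup_{x\in C}F(x)$ is bounded for every compact $C\subset\mathsf X$). Let $(x_k)_{k\ge0}\subset\mathsf X$ be a $K$-projected perturbed approximate discretization ($K$-PPAD) of $F$: there are points $y_k\in\mathsf X$, $k\ge1$, with $$x_k\in\Pi_K\bigl(x_{k-1}+\gamma_k\{F(y_k)+\eta_k\}\bigr),\qquad k\ge1,$$ where $\Pi_C$ denotes the nearest-point projection onto a closed convex set $C$ and $\Pi_C(A)=\{\Pi_C(a):a\in A\}$. Assume $\lim_k\|x_k-y_k\|=0$; $\gamma_k>0$, $\sum_{k\ge1}\gamma_k=\infty$ and $\lim_k\gamma_k=0$; and $\eta_k=e_k+r_k$, where $\lim_k\|r_k\|=0$, the series $\sum_{k\ge1}\gamma_ke_k$ converges, and $\sup_{k\ge1}\|e_k\|<\infty$. For $x\in K$ let $T_K(x)=\mathrm{cl}\{v\in\mathbb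 R^d:\exists\,\varepsilon>0,\ x+\varepsilon v\in K\}$ be the tangent cone of $K$ at $x$. Let $V:\mathsf X\to\mathbb R$ be locally Lipschitz and regular, i.e. for all $x\in\mathsf X$ and $h\in\mathbb R^d$ the limit $\lim_{\lambda\downarrow0}\lambda^{-1}(V(x+\lambda h)-V(x))$ exists and equals Clarke's generalized directional derivative $$V^0(x,h)=\limsup_{u\to0,\ \lambda\downarrow0}\lambda^{-1}\bigl(V(x+u+\lambda h)-V(x+u)\bigr).$$ Let $\bar\partial V(x)=\{w\in\mathbb R^d:\langle h,w\rangle\le V^0(x,h)\ \text{for all } h\in\mathbb R^d\}$ be the Clarke generalized gradient, and for a set-valued map $G$ let $$\mathcal L_GV(x)=\{a\in\mathbb R:\exists\,v\in G(x)\ \text{such that}\ \langle v,w\rangle=a\ \text{for all } w\in\bar\partial V(x)\}$$ be the set-valued Lie derivative. Suppose there is an upper semicontinuous function $U:\mathsf X\to\mathbb R$ such that, for all $x\in K$, $$\sup\mathcal L_{\Pi_{T_K}(F)}V(x)\le U(x)\le0,$$ where $\Pi_{T_K}(F)(x)=\Pi_{T_K(x)}(F(x))$ and $\sup\emptyset=-\infty$.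 Set $\mathcal S=\{x\in\mathsf X:U(x)=0\}$. Then: (i) The image under $V$ of the set of limit points of $(x_k)$ is a (nonempty) compact interval contained in $V(\mathcal S\cap K)$. (ii) If $V(\mathcal S\cap K)$ has empty interior in $\mathbb R$, then $x_k\to\mathcal S\cap K$; that is, $\mathcal S\cap K$ is nonempty and $\lim_{k\to\infty}\mathrm{dist}(x_k,\mathcal S\cap K)=0$. -/

import Mathlib

open Filter Topology Set

noncomputable section

/-- The state space `ℝ^d` with its Euclidean norm. -/
abbrev Eucl (d : ℕ) : Type := EuclideanSpace ℝ (Fin d)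

/-- The image `Π_C(A) = {Π_C(a) : a ∈ A}` of a set `A` under the nearest-point projection onto `C`
(for nonempty closed convex `C` every point has exactly one nearest point in `C`). -/
def projSet {d : ℕ} (C A : Set (Eucl d)) : Set (Eucl d) :=
  {p | p ∈ C ∧ ∃ a ∈ A, ∀ z ∈ C, dist a p ≤ dist a z}

/-- The tangent cone of a convex set `K` at `x`. -/
def convexTangentCone {d : ℕ} (K : Set (Eucl d)) (x : Eucl d) : Set (Eucl d) :=
  closure {v | ∃ ε : ℝ, 0 < ε ∧ x + ε • v ∈ K}

/-- The projected field `x ↦ Π_{T_K(x)}(F(x))`. -/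
def projField {d : ℕ} (K : Set (Eucl d)) (F : Eucl d → Set (Eucl d)) (x : Eucl d) :
    Set (Eucl d) :=
  projSet (convexTangentCone K x) (F x)

/-- Clarke's generalized directional derivative
`f⁰(x, h) = limsup_{u → 0, t ↓ 0} (f (x + u + t h) - f (x + u)) / t`
(a finite upper limit whenever `f` is Lipschitz near `x`). -/
def clarkeDeriv {d : ℕ} (f : Eucl d → ℝ) (x h : Eucl d) : ℝ :=
  limsup (fun p : Eucl d × ℝ => (f (x + p.1 + p.2 • h) - f (x + p.1)) / p.2)
    (𝓝 (0 : Eucl d) ×ˢ 𝓝[>] (0 : ℝ))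

/-- The Clarke generalized gradient. -/
def clarkeGradient {d : ℕ} (f : Eucl d → ℝ) (x : Eucl d) : Set (Eucl d) :=
  {w | ∀ h : Eucl d, inner ℝ h w ≤ clarkeDeriv f x h}

/-- `f` is regular at `x`: all one-sided directional derivatives exist and agree with the
generalized ones. -/
def ClarkeRegularAt {d : ℕ} (f : Eucl d → ℝ) (x : Eucl d) : Prop :=
  ∀ h : Eucl d,
    Tendsto (fun t : ℝ => (f (x + t • h) - f x) / t) (𝓝[>] 0) (𝓝 (clarkeDeriv f x h))

/-- The set-valued Lie derivative of `V` with respect to the set-valued field `G` at `x`. -/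
def lieDeriv {d : ℕ} (G : Eucl d → Set (Eucl d)) (V : Eucl d → ℝ) (x : Eucl d) : Set ℝ :=
  {a | ∃ v ∈ G x, ∀ w ∈ clarkeGradient V x, inner ℝ v w = a}

/-- Assumption on the field: `X` is open and `F` is upper hemicontinuous on `X` with nonempty convex
compact values, and bounded on compact subsets of `X`. Only the values of `F` on `X` matter. -/
structure FieldAssumption {d : ℕ} (X : Set (Eucl d)) (F : Eucl d → Set (Eucl d)) : Prop where
  isOpen : IsOpen X
  nonempty : ∀ x ∈ X, (F x).Nonempty
  upperHemicontinuousOn : UpperHemicontinuousOn F X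
  convex : ∀ x ∈ X, Convex ℝ (F x)
  isCompact : ∀ x ∈ X, IsCompact (F x)
  locallyBounded : ∀ C : Set (Eucl d), IsCompact C → C ⊆ X → Bornology.IsBounded (⋃ x ∈ C, F x)

/-- Assumption on the step sizes `γ 1, γ 2, …`. -/
structure StepAssumption (γ : ℕ → ℝ) : Prop where
  pos : ∀ k, 1 ≤ k → 0 < γ k
  sum_diverges : Tendsto (fun n => ∑ k ∈ Finset.Icc 1 n, γ k) atTop atTop
  tendsto_zero : Tendsto γ atTop (𝓝 0)

/-- Assumption on the noise `η 1, η 2, …`, with its decomposition `η = e + r`. -/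
structure NoiseAssumption {d : ℕ} (γ : ℕ → ℝ) (η e r : ℕ → Eucl d) : Prop where
  decomp : ∀ k, 1 ≤ k → η k = e k + r k
  tendsto_zero : Tendsto (fun k => ‖r k‖) atTop (𝓝 0)
  series_converges : ∃ s : Eucl d, Tendsto (fun n => ∑ k ∈ Finset.Icc 1 n, γ k • e k) atTop (𝓝 s)

/-- Assumption on the approximation sequence `y 1, y 2, …`. -/
structure ApproxAssumption {d : ℕ} (X : Set (Eucl d)) (x y : ℕ → Eucl d) : Prop where
  mem : ∀ k, 1 ≤ k → y k ∈ X
  tendsto_zero : Tendsto (fun k => ‖x k - y k‖) atTop (𝓝 0)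

/-- `(x k)_{k ≥ 0}` in `X` is a `K`-projected perturbed approximate discretization of `F` with noise
`η`, step sizes `γ` and approximation sequence `y`:
`x (k+1) ∈ Π_K (x k + γ (k+1) {F (y (k+1)) + η (k+1)})`. -/
structure IsPPAD {d : ℕ} (X K : Set (Eucl d)) (F : Eucl d → Set (Eucl d))
    (x y : ℕ → Eucl d) (γ : ℕ → ℝ) (η : ℕ → Eucl d) : Prop where
  mem : ∀ k, x k ∈ X
  step : ∀ k, x (k + 1) ∈
    projSet K ((fun v => x k + γ (k + 1) • (v + η (k + 1))) '' F (y (k + 1)))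

/-- The limit points (limits of subsequences) of a sequence. -/
def limitPoints {d : ℕ} (x : ℕ → Eucl d) : Set (Eucl d) :=
  {p | ∃ φ : ℕ → ℕ, StrictMono φ ∧ Tendsto (fun k => x (φ k)) atTop (𝓝 p)}

end

/-!
On the clock `τ n = γ 1 + ⋯ + γ n` the sequence moves with velocities `f + r - q`, where `f` lies in
`F` at a nearby point and `q` is normal to `K`, up to the increments of the convergent series
`∑ γ k • e k`. The velocities are bounded, so along an ultrafilter the time-shifted interpolations
of the sequence converge to Lipschitz trajectories in `K`. Where such a trajectory `z` is
differentiable, its derivative is a limit of average velocities, hence of the form `f - q` with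
`f ∈ F (z t)` and `q` normal to `K` at `z t`. As `z` stays in `K`, this derivative is tangent to `K`
in both directions, which forces `f - q` to be the projection of `f` onto the tangent cone. By
regularity of `V`, the derivative of `V ∘ z` then belongs to the Lie derivative, and `V` decreases
strictly along limit trajectories that start outside `S`.

If `V ∘ x` is infinitely often below `c` and infinitely often above some `c' > c`, consider the
times at which it starts crossing from `c` to `c'`. A limit trajectory based at such times starts on
the level `c` and does not drop below it immediately, so it starts in `S`. Hence every level
strictly between the extreme values of `V` on the limit points is attained at a limit point in `S`.
If `V` is constant on the limit points, no limit trajectory decreases `V`, so every limit point is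
in `S`.
-/

/-- A strictly increasing unbounded sequence of times with vanishing increments. -/
structure IsClock (τ : ℕ → ℝ) : Prop where
  strictMono : StrictMono τ
  tendsto_time : Tendsto τ atTop atTop
  tendsto_increment : Tendsto (fun k => τ (k + 1) - τ k) atTop (𝓝 0)

/-- The last index whose time is at most `s`, by the convention `sSup ∅ = 0` equal to `0` before
time `τ 0`. It turns shifts in continuous time into shifts of the index. -/
noncomputable def lastIndex (τ : ℕ → ℝ) (s : ℝ) : ℕ := sSup {k | τ k ≤ s}

namespace IsClock

variable {τ : ℕ → ℝ}

lemma le_lastIndex_iff (hτ : IsClock τ) {s : ℝ} (hs : τ 0 ≤ s) {k : ℕ} :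
    k ≤ lastIndex τ s ↔ τ k ≤ s := by
  have hbdd : BddAbove {k | τ k ≤ s} := by
    obtain ⟨n, hn⟩ := (hτ.tendsto_time.eventually_gt_atTop s).exists
    exact ⟨n, fun k hk => (hτ.strictMono.lt_iff_lt.1 (hk.trans_lt hn)).le⟩
  refine ⟨fun hk => (hτ.strictMono.monotone hk).trans ?_, fun hk => le_csSup hbdd hk⟩
  exact Nat.sSup_mem ⟨0, hs⟩ hbdd

lemma lastIndex_apply (hτ : IsClock τ) (j : ℕ) : lastIndex τ (τ j) = j :=
  eq_of_forall_le_iff fun _ =>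
    (hτ.le_lastIndex_iff (hτ.strictMono.monotone j.zero_le)).trans hτ.strictMono.le_iff_le

lemma tendsto_lastIndex (hτ : IsClock τ) : Tendsto (lastIndex τ) atTop atTop :=
  tendsto_atTop.2 fun k => by
    filter_upwards [eventually_ge_atTop (τ 0), eventually_ge_atTop (τ k)] with s h0 hk
    exact (hτ.le_lastIndex_iff h0).2 hk

lemma tendsto_apply_lastIndex_sub (hτ : IsClock τ) :
    Tendsto (fun s => τ (lastIndex τ s) - s) atTop (𝓝 0) := by
  have hincr := (hτ.tendsto_increment.comp hτ.tendsto_lastIndex).neg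
  rw [neg_zero] at hincr
  refine tendsto_of_tendsto_of_tendsto_of_le_of_le' hincr tendsto_const_nhds ?_ ?_
  all_goals filter_upwards [eventually_ge_atTop (τ 0)] with s hs
  · have hlt : s < τ (lastIndex τ s + 1) :=
      not_le.1 fun h => Nat.not_succ_le_self _ ((hτ.le_lastIndex_iff hs).2 h)
    simp only [Function.comp_apply]
    linarith
  · exact sub_nonpos.2 ((hτ.le_lastIndex_iff hs).1 le_rfl)

lemma tendsto_add_const (hτ : IsClock τ) (t : ℝ) : Tendsto (fun j => τ j + t) atTop atTop :=
  tendsto_atTop_add_const_right _ t hτ.tendsto_time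

lemma tendsto_lastIndex_add (hτ : IsClock τ) (t : ℝ) :
    Tendsto (fun j => lastIndex τ (τ j + t)) atTop atTop :=
  hτ.tendsto_lastIndex.comp (hτ.tendsto_add_const t)

lemma eventually_lastIndex_add_le (hτ : IsClock τ) {s t : ℝ} (hst : s ≤ t) :
    ∀ᶠ j in atTop, lastIndex τ (τ j + s) ≤ lastIndex τ (τ j + t) := by
  filter_upwards [(hτ.tendsto_add_const s).eventually_ge_atTop (τ 0)] with j hj
  have hst' : τ j + s ≤ τ j + t := by gcongr
  exact (hτ.le_lastIndex_iff (hj.trans hst')).2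
    (((hτ.le_lastIndex_iff hj).1 le_rfl).trans hst')

lemma tendsto_apply_lastIndex_add_sub (hτ : IsClock τ) (s t : ℝ) :
    Tendsto (fun j => τ (lastIndex τ (τ j + t)) - τ (lastIndex τ (τ j + s))) atTop
      (𝓝 (t - s)) := by
  have hgap (u : ℝ) := hτ.tendsto_apply_lastIndex_sub.comp (hτ.tendsto_add_const u)
  convert ((hgap t).sub (hgap s)).add_const (t - s) using 1
  · ext j
    simp only [Function.comp_apply]
    ring
  · simp

end IsClock

/-- The sequence `x` moves with the velocities `v`, bounded by `M` from some index on, between the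
times of the clock `τ`, up to the increments of a convergent perturbation `ζ`. -/
structure IsDrivenBy {E : Type*} [NormedAddCommGroup E] [NormedSpace ℝ E]
    (τ : ℕ → ℝ) (x v ζ : ℕ → E) (M : ℝ) : Prop where
  clock : IsClock τ
  step : ∀ k, x (k + 1) - x k = (τ (k + 1) - τ k) • v k + (ζ (k + 1) - ζ k)
  norm_le : ∀ᶠ k in atTop, ‖v k‖ ≤ M
  converges : ∃ a, Tendsto ζ atTop (𝓝 a)

/-- `z` is the limit along `l` of the piecewise constant interpolations of `x` on the clock `τ`,
the `j`-th one being shifted in time so that it passes through `x j` at time `0`. -/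
def IsLimitTrajectory {E : Type*} [TopologicalSpace E] (τ : ℕ → ℝ) (x : ℕ → E) (l : Filter ℕ)
    (z : ℝ → E) : Prop :=
  ∀ t, Tendsto (fun j => x (lastIndex τ (τ j + t))) l (𝓝 (z t))

namespace IsLimitTrajectory

variable {E : Type*} [TopologicalSpace E] {τ : ℕ → ℝ} {x : ℕ → E} {l : Filter ℕ} {z : ℝ → E}

lemma tendsto_zero (hz : IsLimitTrajectory τ x l z) (hτ : IsClock τ) :
    Tendsto x l (𝓝 (z 0)) := by
  simpa only [add_zero, hτ.lastIndex_apply] using hz 0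

lemma mapClusterPt [NeBot l] (hz : IsLimitTrajectory τ x l z) (hτ : IsClock τ) (hl : l ≤ atTop)
    (t : ℝ) : MapClusterPt (z t) atTop x :=
  MapClusterPt.of_comp ((hτ.tendsto_lastIndex_add t).mono_left hl) (hz t).mapClusterPt

end IsLimitTrajectory

lemma exists_isLimitTrajectory {E : Type*} [TopologicalSpace E] {τ : ℕ → ℝ} {x : ℕ → E}
    {K : Set E} (hτ : IsClock τ) (hK : IsCompact K) (hx : ∀ᶠ k in atTop, x k ∈ K)
    (l : Ultrafilter ℕ) (hl : ↑l ≤ (atTop : Filter ℕ)) :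
    ∃ z, IsLimitTrajectory τ x l z := by
  have hlim (t : ℝ) : ∃ p ∈ K, Tendsto (fun j => x (lastIndex τ (τ j + t))) l (𝓝 p) :=
    hK.ultrafilter_le_nhds (l.map _)
      (le_principal_iff.2 (((hτ.tendsto_lastIndex_add t).mono_left hl).eventually hx))
  choose z _ hz using hlim
  exact ⟨z, hz⟩

namespace IsDrivenBy

variable {E : Type*} [NormedAddCommGroup E] [NormedSpace ℝ E] {τ : ℕ → ℝ} {x v ζ : ℕ → E} {M : ℝ}
  {l : Filter ℕ} {z : ℝ → E}

lemma nonneg (h : IsDrivenBy τ x v ζ M) : 0 ≤ M :=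
  h.norm_le.exists.elim fun _ hk => (norm_nonneg _).trans hk

lemma sub_eq_sum (h : IsDrivenBy τ x v ζ M) {i j : ℕ} (hij : i ≤ j) :
    x j - x i = ∑ k ∈ Finset.Ico i j, (τ (k + 1) - τ k) • v k + (ζ j - ζ i) := by
  rw [← Finset.sum_Ico_sub x hij, ← Finset.sum_Ico_sub ζ hij, ← Finset.sum_add_distrib]
  exact Finset.sum_congr rfl fun k _ => h.step k

lemma eventually_dist_le (h : IsDrivenBy τ x v ζ M) {ε : ℝ} (hε : 0 < ε) :
    ∀ᶠ i in atTop, ∀ j ≥ i, dist (x j) (x i) ≤ M * (τ j - τ i) + ε := by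
  obtain ⟨_, hζ⟩ := h.converges
  obtain ⟨N, hN⟩ := Metric.cauchySeq_iff.1 hζ.cauchySeq ε hε
  filter_upwards [eventually_forall_ge_atTop.2 h.norm_le, eventually_ge_atTop N] with i hv hi j hij
  have hdrift : ‖∑ k ∈ Finset.Ico i j, (τ (k + 1) - τ k) • v k‖ ≤ M * (τ j - τ i) := by
    rw [← Finset.sum_Ico_sub τ hij, Finset.mul_sum]
    refine norm_sum_le_of_le _ fun k hk => ?_
    have hpos : 0 ≤ τ (k + 1) - τ k := sub_nonneg.2 (h.clock.strictMono k.lt_succ_self).le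
    rw [norm_smul, Real.norm_of_nonneg hpos, mul_comm]
    exact mul_le_mul_of_nonneg_right (hv k (Finset.mem_Ico.1 hk).1) hpos
  have hnoise := (hN j (hi.trans hij) i hi).le
  rw [dist_eq_norm] at hnoise ⊢
  rw [h.sub_eq_sum hij]
  exact (norm_add_le _ _).trans (add_le_add hdrift hnoise)

lemma average_mem (h : IsDrivenBy τ x v ζ M) {A : Set E} (hA : Convex ℝ A) {i j : ℕ} (hij : i < j)
    (hv : ∀ k ∈ Finset.Ico i j, v k ∈ A) :
    (τ j - τ i)⁻¹ • (x j - x i - (ζ j - ζ i)) ∈ A := by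
  have hpos : 0 < ∑ k ∈ Finset.Ico i j, (τ (k + 1) - τ k) := by
    rw [Finset.sum_Ico_sub τ hij.le]
    exact sub_pos.2 (h.clock.strictMono hij)
  have hmem := hA.centerMass_mem (w := fun k => τ (k + 1) - τ k)
    (fun k _ => sub_nonneg.2 (h.clock.strictMono k.lt_succ_self).le) hpos hv
  rwa [Finset.centerMass, Finset.sum_Ico_sub τ hij.le, ← add_sub_cancel_right (Finset.sum _ _)
    (ζ j - ζ i), ← h.sub_eq_sum hij.le] at hmem

lemma lipschitzWith (h : IsDrivenBy τ x v ζ M) [NeBot l] (hl : l ≤ atTop)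
    (hz : IsLimitTrajectory τ x l z) : LipschitzWith M.toNNReal z := by
  refine LipschitzWith.of_dist_le_mul fun t s => ?_
  rw [Real.coe_toNNReal _ h.nonneg, Real.dist_eq]
  wlog hst : s ≤ t generalizing s t
  · rw [dist_comm, abs_sub_comm]
    exact this s t (le_of_not_ge hst)
  rw [abs_of_nonneg (sub_nonneg.2 hst)]
  refine le_of_forall_pos_le_add fun ε hε => ?_
  have hgap := ((h.clock.tendsto_apply_lastIndex_add_sub s t).const_mul M).add_const ε
  refine le_of_tendsto_of_tendsto ((hz t).dist (hz s)) (hgap.mono_left hl) (hl ?_)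
  filter_upwards [(h.clock.tendsto_lastIndex_add s).eventually (h.eventually_dist_le hε),
    h.clock.eventually_lastIndex_add_le hst] with j hdist hle
  exact hdist _ hle

lemma eventually_forall_Icc_mem (h : IsDrivenBy τ x v ζ M) (hl : l ≤ atTop)
    (hz : IsLimitTrajectory τ x l z) {t : ℝ} {W : Set E} (hW : W ∈ 𝓝 (z t)) :
    ∀ᶠ s in 𝓝[>] 0, ∀ᶠ j in l,
      ∀ k ∈ Icc (lastIndex τ (τ j + t)) (lastIndex τ (τ j + (t + s))), x k ∈ W := by
  obtain ⟨δ, hδ, hball⟩ := Metric.mem_nhds_iff.1 hW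
  have hshort : ∀ᶠ s in 𝓝[>] (0 : ℝ), M * s < δ / 3 := by
    refine nhdsWithin_le_nhds ((continuous_const_mul M).continuousAt.eventually_lt_const ?_)
    simpa only [mul_zero] using div_pos hδ three_pos
  filter_upwards [hshort] with s hs
  have hgap := (h.clock.tendsto_apply_lastIndex_add_sub t (t + s)).const_mul M
  rw [add_sub_cancel_left] at hgap
  filter_upwards [(hz t).eventually (Metric.ball_mem_nhds _ (div_pos hδ three_pos)),
    hl (hgap.eventually_lt_const hs),
    hl ((h.clock.tendsto_lastIndex_add t).eventually
      (h.eventually_dist_le (div_pos hδ three_pos)))] with j hstart htime hdist k hk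
  have hmono : M * (τ k - τ (lastIndex τ (τ j + t))) ≤
      M * (τ (lastIndex τ (τ j + (t + s))) - τ (lastIndex τ (τ j + t))) :=
    mul_le_mul_of_nonneg_left (sub_le_sub_right (h.clock.strictMono.monotone hk.2) _) h.nonneg
  refine hball (Metric.mem_ball.2
    ((dist_triangle _ (x (lastIndex τ (τ j + t))) _).trans_lt ?_))
  linarith [hdist k hk.1, Metric.mem_ball.1 hstart]

/-- A difference quotient of the limit trajectory is a limit of average velocities. -/
lemma hasDerivAt_mem [NeBot l] (h : IsDrivenBy τ x v ζ M) (hl : l ≤ atTop)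
    (hz : IsLimitTrajectory τ x l z) {t : ℝ} {w : E} (hw : HasDerivAt z w t) {A W : Set E}
    (hA : Convex ℝ A) (hA_closed : IsClosed A) (hW : W ∈ 𝓝 (z t))
    (hv : ∀ᶠ k in atTop, x (k + 1) ∈ W → v k ∈ A) : w ∈ A := by
  refine hA_closed.mem_of_tendsto hw.tendsto_slope_zero_right ?_
  filter_upwards [h.eventually_forall_Icc_mem hl hz hW, self_mem_nhdsWithin] with s hxW hs
  have hgap := h.clock.tendsto_apply_lastIndex_add_sub t (t + s)
  rw [add_sub_cancel_left] at hgap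
  obtain ⟨_, hζ⟩ := h.converges
  have hnoise := (hζ.comp (h.clock.tendsto_lastIndex_add (t + s))).sub
    (hζ.comp (h.clock.tendsto_lastIndex_add t))
  rw [sub_self] at hnoise
  have haverage := ((hgap.mono_left hl).inv₀ hs.ne').smul
    (((hz (t + s)).sub (hz t)).sub (hnoise.mono_left hl))
  rw [sub_zero] at haverage
  refine hA_closed.mem_of_tendsto haverage ?_
  filter_upwards [hxW, hl (hgap.eventually_const_lt hs),
    hl ((h.clock.tendsto_lastIndex_add t).eventually (eventually_forall_ge_atTop.2 hv))]
    with j hjW hpos hjA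
  have hlt := h.clock.strictMono.lt_iff_lt.1 (sub_pos.1 hpos)
  refine h.average_mem hA hlt fun k hk => ?_
  obtain ⟨hik, hkj⟩ := Finset.mem_Ico.1 hk
  exact hjA k hik (hjW (k + 1) ⟨hik.trans k.le_succ, hkj⟩)

end IsDrivenBy

/-- The sequence `a` is at most `c` at the index `j` and then stays above `c` until it exceeds
`c'`. -/
def IsUpcrossing (a : ℕ → ℝ) (c c' : ℝ) (j : ℕ) : Prop :=
  a j ≤ c ∧ ∃ k > j, c' < a k ∧ ∀ i ∈ Ioc j k, c < a i

lemma frequently_isUpcrossing {a : ℕ → ℝ} {c c' : ℝ} (hc : c ≤ c')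
    (hlow : ∃ᶠ k in atTop, a k ≤ c) (hhigh : ∃ᶠ k in atTop, c' < a k) :
    ∃ᶠ j in atTop, IsUpcrossing a c c' j := by
  refine frequently_atTop.2 fun N => ?_
  obtain ⟨m, hNm, hm⟩ := frequently_atTop.1 hlow N
  obtain ⟨k, hmk, hk⟩ := frequently_atTop.1 hhigh m
  have hmj : m ≤ Nat.findGreatest (a · ≤ c) k := Nat.le_findGreatest hmk hm
  have hj : a (Nat.findGreatest (a · ≤ c) k) ≤ c := Nat.findGreatest_spec (P := (a · ≤ c)) hmk hm
  refine ⟨_, hNm.trans hmj, hj, k, (Nat.findGreatest_le k).lt_of_ne fun h => ?_, hk,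
    fun i hi => not_le.1 (Nat.findGreatest_is_greatest hi.1 hi.2)⟩
  exact (hc.trans_lt hk).not_ge (h ▸ hj)

/-- `V` takes values below `V (z 0)` at arbitrarily small positive times along every limit
trajectory `z` of `x` that starts outside `S`. -/
def DecreasesOff {E : Type*} [TopologicalSpace E] (τ : ℕ → ℝ) (x : ℕ → E) (V : E → ℝ)
    (S : Set E) : Prop :=
  ∀ (l : Ultrafilter ℕ) (z : ℝ → E), ↑l ≤ (atTop : Filter ℕ) → IsLimitTrajectory τ x l z →
    z 0 ∉ S → ∃ᶠ t in 𝓝[>] 0, V (z t) < V (z 0)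

section ClusterPoints

variable {ι E : Type*} [TopologicalSpace E] {l : Filter ι} {u : ι → E} {K : Set E} {V : E → ℝ}
  {p : E}

lemma tendsto_comp_of_continuousOn (hV : ContinuousOn V K) (hK : IsClosed K) [NeBot l]
    (hu : Tendsto u l (𝓝 p)) (huK : ∀ᶠ i in l, u i ∈ K) :
    Tendsto (fun i => V (u i)) l (𝓝 (V p)) :=
  (hV p (hK.mem_of_tendsto hu huK)).tendsto.comp (tendsto_nhdsWithin_iff.2 ⟨hu, huK⟩)

lemma mapClusterPt_comp_of_continuousOn (hV : ContinuousOn V K) (hK : IsClosed K)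
    (hp : MapClusterPt p l u) (huK : ∀ᶠ i in l, u i ∈ K) : MapClusterPt (V p) l (V ∘ u) :=
  hp.tendsto_comp' ((hV p (hK.mem_of_mapClusterPt hp huK)).mono_left
    (inf_le_inf_left _ (le_principal_iff.2 huK)))

lemma isCompact_setOf_mapClusterPt (hK : IsCompact K) (hKc : IsClosed K)
    (huK : ∀ᶠ i in l, u i ∈ K) : IsCompact {p | MapClusterPt p l u} :=
  hK.of_isClosed_subset isClosed_setOfPred_clusterPt fun _ hp => hKc.mem_of_mapClusterPt hp huK

end ClusterPoints

lemma DecreasesOff.mem_of_forall_mapClusterPt_eq {E : Type*} [TopologicalSpace E] [T2Space E]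
    {τ : ℕ → ℝ} {x : ℕ → E} {V : E → ℝ} {K S : Set E} (h : DecreasesOff τ x V S)
    (hτ : IsClock τ) (hK : IsCompact K) (hx : ∀ᶠ k in atTop, x k ∈ K) {c : ℝ}
    (hconst : ∀ p, MapClusterPt p atTop x → V p = c) {p : E} (hp : MapClusterPt p atTop x) :
    p ∈ S := by
  obtain ⟨l, hl, hlp⟩ := mapClusterPt_iff_ultrafilter.1 hp
  obtain ⟨z, hz⟩ := exists_isLimitTrajectory hτ hK hx l hl
  rw [← tendsto_nhds_unique (hz.tendsto_zero hτ) hlp]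
  by_contra hzS
  obtain ⟨t, ht⟩ := (h l z hl hz hzS).exists
  rw [hconst _ (hz.mapClusterPt hτ hl t), hconst _ (hz.mapClusterPt hτ hl 0)] at ht
  exact lt_irrefl c ht

namespace IsDrivenBy

variable {E : Type*} [NormedAddCommGroup E] [NormedSpace ℝ E] {τ : ℕ → ℝ} {x v ζ : ℕ → E} {M : ℝ}
  {l : Filter ℕ} {z : ℝ → E} {K S : Set E} {V : E → ℝ}

lemma eventually_le_of_isUpcrossing [NeBot l] (h : IsDrivenBy τ x v ζ M) (hl : l ≤ atTop)
    (hz : IsLimitTrajectory τ x l z) (hK : IsClosed K) (hx : ∀ᶠ k in atTop, x k ∈ K)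
    (hV : ContinuousOn V K) {c c' : ℝ} (hup : ∀ᶠ j in l, IsUpcrossing (V ∘ x) c c' j)
    (hc : V (z 0) < c') : ∀ᶠ t in 𝓝[>] 0, c ≤ V (z t) := by
  have hzK (t : ℝ) : z t ∈ K := hK.mem_of_mapClusterPt (hz.mapClusterPt h.clock hl t) hx
  have hW : {p | p ∈ K → V p < c'} ∈ 𝓝 (z 0) :=
    eventually_nhdsWithin_iff.1 ((hV _ (hzK 0)).eventually_lt_const hc)
  filter_upwards [h.eventually_forall_Icc_mem hl hz hW, self_mem_nhdsWithin] with t hloc ht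
  have hgap := h.clock.tendsto_apply_lastIndex_add_sub 0 t
  simp only [zero_add, add_zero, sub_zero, h.clock.lastIndex_apply] at hloc hgap
  have hindex := (h.clock.tendsto_lastIndex_add t).mono_left hl
  refine ge_of_tendsto (tendsto_comp_of_continuousOn hV hK (hz t) (hindex.eventually hx)) ?_
  filter_upwards [hup, hloc, hl (hgap.eventually_const_lt ht),
    hl (eventually_forall_ge_atTop.2 hx)] with j ⟨_, k, hjk, hk, habove⟩ hlow hpos hjK
  refine (habove _ ⟨h.clock.strictMono.lt_iff_lt.1 (sub_pos.1 hpos), ?_⟩).le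
  by_contra! hlt
  exact (hlow k ⟨hjk.le, hlt.le⟩ (hjK k hjk.le)).not_gt hk

lemma exists_mapClusterPt_of_frequently (h : IsDrivenBy τ x v ζ M) (hK : IsCompact K)
    (hx : ∀ᶠ k in atTop, x k ∈ K) (hV : ContinuousOn V K) (hdec : DecreasesOff τ x V S)
    {c c' : ℝ} (hc : c < c') (hlow : ∃ᶠ k in atTop, V (x k) ≤ c)
    (hhigh : ∃ᶠ k in atTop, c' < V (x k)) : ∃ p ∈ S, MapClusterPt p atTop x ∧ V p = c := by
  have : NeBot (atTop ⊓ 𝓟 {j | IsUpcrossing (V ∘ x) c c' j}) := frequently_mem_iff_neBot.1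
    (frequently_isUpcrossing (a := V ∘ x) hc.le hlow hhigh)
  obtain ⟨l, hl⟩ := Ultrafilter.exists_le (atTop ⊓ 𝓟 {j | IsUpcrossing (V ∘ x) c c' j})
  obtain ⟨hl, hup⟩ := le_inf_iff.1 hl
  have hup : ∀ᶠ j in (l : Filter ℕ), IsUpcrossing (V ∘ x) c c' j := le_principal_iff.1 hup
  obtain ⟨z, hz⟩ := exists_isLimitTrajectory h.clock hK hx l hl
  have hzK (t : ℝ) : z t ∈ K := hK.isClosed.mem_of_mapClusterPt (hz.mapClusterPt h.clock hl t) hx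
  have hle : V (z 0) ≤ c :=
    le_of_tendsto (tendsto_comp_of_continuousOn hV hK.isClosed (hz.tendsto_zero h.clock) (hl hx))
      (hup.mono fun _ hj => hj.1)
  have hge : ∀ᶠ t in 𝓝[>] 0, c ≤ V (z t) :=
    h.eventually_le_of_isUpcrossing hl hz hK.isClosed hx hV hup (hle.trans_lt hc)
  have hVz : Tendsto (fun t => V (z t)) (𝓝[>] 0) (𝓝 (V (z 0))) :=
    tendsto_comp_of_continuousOn hV hK.isClosed
      ((h.lipschitzWith hl hz).continuous.continuousAt.mono_left nhdsWithin_le_nhds)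
      (.of_forall hzK)
  have heq : V (z 0) = c := hle.antisymm (ge_of_tendsto hVz hge)
  refine ⟨z 0, ?_, hz.mapClusterPt h.clock hl 0, heq⟩
  by_contra hzS
  obtain ⟨t, hlt, hct⟩ := ((hdec l z hl hz hzS).and_eventually hge).exists
  exact (heq ▸ hlt).not_ge hct

theorem exists_image_mapClusterPt_eq_Icc (h : IsDrivenBy τ x v ζ M) (hK : IsCompact K)
    (hx : ∀ᶠ k in atTop, x k ∈ K) (hV : ContinuousOn V K) (hS : IsClosed (S ∩ K))
    (hdec : DecreasesOff τ x V S) :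
    ∃ a b, a ≤ b ∧ V '' {p | MapClusterPt p atTop x} = Icc a b ∧ Icc a b ⊆ V '' (S ∩ K) := by
  set L := {p | MapClusterPt p atTop x}
  have hLK : L ⊆ K := fun p hp => hK.isClosed.mem_of_mapClusterPt hp hx
  have hL : IsCompact L := isCompact_setOf_mapClusterPt hK hK.isClosed hx
  obtain ⟨p₀, -, hp₀⟩ := hK.exists_mapClusterPt (le_principal_iff.2 hx)
  obtain ⟨pa, hpa, hmin⟩ := hL.exists_isMinOn ⟨p₀, hp₀⟩ (hV.mono hLK)
  obtain ⟨pb, hpb, hmax⟩ := hL.exists_isMaxOn ⟨p₀, hp₀⟩ (hV.mono hLK)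
  have hVpa := mapClusterPt_comp_of_continuousOn hV hK.isClosed hpa hx
  have hVpb := mapClusterPt_comp_of_continuousOn hV hK.isClosed hpb hx
  have hIcc : Icc (V pa) (V pb) ⊆ V '' (L ∩ (S ∩ K)) := by
    have hab : V pa ≤ V pb := hmin hpb
    rcases hab.eq_or_lt with heq | hlt
    · have hconst (p : E) (hp : p ∈ L) : V p = V pa :=
        ((hmax hp).trans_eq heq.symm).antisymm (hmin hp)
      rw [← heq, Icc_self, singleton_subset_iff]
      exact ⟨pa, ⟨hpa, hdec.mem_of_forall_mapClusterPt_eq h.clock hK hx hconst hpa, hLK hpa⟩, rfl⟩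
    · have hcompact : IsCompact (V '' (L ∩ (S ∩ K))) :=
        (hL.inter_right hS).image_of_continuousOn (hV.mono fun p hp => hLK hp.1)
      rw [← closure_Ioo hlt.ne]
      refine closure_minimal (fun c hc => ?_) hcompact.isClosed
      obtain ⟨c', hcc', hc'⟩ := exists_between hc.2
      obtain ⟨p, hpS, hp, rfl⟩ := h.exists_mapClusterPt_of_frequently hK hx hV hdec hcc'
        (hVpa.frequently (Iic_mem_nhds hc.1)) (hVpb.frequently (Ioi_mem_nhds hc'))
      exact ⟨p, ⟨hp, hpS, hLK hp⟩, rfl⟩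
  refine ⟨V pa, V pb, hmin hpb, Subset.antisymm ?_ (hIcc.trans (image_mono inter_subset_left)),
    hIcc.trans (image_mono inter_subset_right)⟩
  rintro _ ⟨p, hp, rfl⟩
  exact ⟨hmin hp, hmax hp⟩

theorem mem_of_mapClusterPt_of_interior_eq_empty (h : IsDrivenBy τ x v ζ M) (hK : IsCompact K)
    (hx : ∀ᶠ k in atTop, x k ∈ K) (hV : ContinuousOn V K) (hS : IsClosed (S ∩ K))
    (hdec : DecreasesOff τ x V S) (hint : interior (V '' (S ∩ K)) = ∅) {p : E}
    (hp : MapClusterPt p atTop x) : p ∈ S := by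
  obtain ⟨a, b, hab, himage, hsub⟩ := h.exists_image_mapClusterPt_eq_Icc hK hx hV hS hdec
  have hIoo : Ioo a b = ∅ := subset_empty_iff.1 (hint ▸ interior_Icc (a := a) ▸ interior_mono hsub)
  obtain rfl : a = b := hab.eq_of_not_lt (Ioo_eq_empty_iff.1 hIoo)
  refine hdec.mem_of_forall_mapClusterPt_eq h.clock hK hx (c := a) (fun q hq => ?_) hp
  exact mem_singleton_iff.1 (Icc_self a ▸ himage ▸ mem_image_of_mem V hq)

end IsDrivenBy

lemma tendsto_infDist_of_forall_mapClusterPt {ι E : Type*} [PseudoMetricSpace E] {l : Filter ι}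
    {u : ι → E} {K A : Set E} (hK : IsCompact K) (huK : ∀ᶠ i in l, u i ∈ K)
    (hA : ∀ p, MapClusterPt p l u → p ∈ A) :
    Tendsto (fun i => Metric.infDist (u i) A) l (𝓝 0) := by
  refine tendsto_iff_ultrafilter _ _ _ |>.2 fun g hg => ?_
  obtain ⟨p, -, hp⟩ := hK.ultrafilter_le_nhds (g.map u) (le_principal_iff.2 (hg huK))
  have hpA : p ∈ A := hA p (mapClusterPt_iff_ultrafilter.2 ⟨g, hg, hp⟩)
  exact Metric.infDist_zero_of_mem hpA ▸ ((Metric.continuous_infDist_pt A).tendsto p).comp hp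

section RelaxedVelocities

open scoped Pointwise

variable {E : Type*} [NormedAddCommGroup E] [InnerProductSpace ℝ E] {A K : Set E} {p q v : E}
  {ε : ℝ}

/-- The `ε`-normals to `K` at `p`; for `ε = 0` this is the normal cone. -/
def epsNormalSet (K : Set E) (ε : ℝ) (p : E) : Set E :=
  {q | ∀ w ∈ K, inner ℝ q (w - p) ≤ ε}

/-- The differences of a point at distance at most `ε` from `A` and an `ε`-normal to `K` at `p`.
For `ε = 0` and `p ∈ K` these are the velocities in `A` corrected by the normal forces that can keep
a motion inside `K`. -/
def relaxedVelocities (K A : Set E) (ε : ℝ) (p : E) : Set E :=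
  Metric.cthickening ε A - epsNormalSet K ε p

lemma epsNormalSet_eq_iInter :
    epsNormalSet K ε p = ⋂ w ∈ K, {q | innerₗ E (w - p) q ≤ ε} := by
  ext q
  simp only [epsNormalSet, mem_ofPred_eq, mem_iInter, innerₗ_apply_apply, real_inner_comm]

lemma convex_epsNormalSet : Convex ℝ (epsNormalSet K ε p) :=
  epsNormalSet_eq_iInter (E := E) ▸ convex_iInter₂ fun w _ =>
    convex_halfSpace_le (innerₗ E (w - p)).isLinear ε

lemma isClosed_epsNormalSet : IsClosed (epsNormalSet K ε p) :=
  epsNormalSet_eq_iInter (E := E) ▸ isClosed_biInter fun w _ =>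
    isClosed_le (innerSL ℝ (w - p)).continuous continuous_const

lemma epsNormalSet_mono {ε' : ℝ} (h : ε ≤ ε') : epsNormalSet K ε p ⊆ epsNormalSet K ε' p :=
  fun _ hq w hw => (hq w hw).trans h

lemma mem_epsNormalSet_of_norm_mul_dist_le {p' : E} (hq : q ∈ epsNormalSet K 0 p')
    (h : ‖q‖ * dist p' p ≤ ε) : q ∈ epsNormalSet K ε p := fun w hw =>
  calc
    inner ℝ q (w - p) = inner ℝ q (w - p') + inner ℝ q (p' - p) := by
      rw [← inner_add_right, sub_add_sub_cancel]
    _ ≤ 0 + ‖q‖ * ‖p' - p‖ := add_le_add (hq w hw) (real_inner_le_norm _ _)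
    _ ≤ ε := by rwa [zero_add, ← dist_eq_norm]

lemma convex_relaxedVelocities (hA : Convex ℝ A) : Convex ℝ (relaxedVelocities K A ε p) :=
  (hA.cthickening ε).sub convex_epsNormalSet

variable [ProperSpace E]

lemma isClosed_relaxedVelocities (hA : IsCompact A) : IsClosed (relaxedVelocities K A ε p) := by
  rw [relaxedVelocities, sub_eq_add_neg]
  exact isClosed_epsNormalSet.neg.add_left_of_isCompact hA.cthickening

theorem mem_sub_epsNormalSet_zero (hA : IsCompact A)
    (hv : ∀ ε > 0, v ∈ relaxedVelocities K A ε p) : v ∈ A - epsNormalSet K 0 p := by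
  let C (ε : Ioi (0 : ℝ)) : Set E :=
    Metric.cthickening ε A ∩ (fun f => f - v) ⁻¹' epsNormalSet K ε p
  have hC_closed (ε : Ioi (0 : ℝ)) : IsClosed (C ε) :=
    Metric.isClosed_cthickening.inter (isClosed_epsNormalSet.preimage (continuous_sub_right v))
  have hC_mono : Monotone C := fun _ _ h => inter_subset_inter (Metric.cthickening_mono h A)
    (preimage_mono (epsNormalSet_mono h))
  have hC_nonempty (ε : Ioi (0 : ℝ)) : (C ε).Nonempty := by
    obtain ⟨f, hf, q, hq, rfl⟩ := hv ε ε.2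
    exact ⟨f, hf, by rwa [mem_preimage, sub_sub_cancel]⟩
  obtain ⟨f, hf⟩ := IsCompact.nonempty_iInter_of_directed_nonempty_isCompact_isClosed C
    hC_mono.directed_ge hC_nonempty
    (fun ε => hA.cthickening.of_isClosed_subset (hC_closed ε) inter_subset_left) hC_closed
  have hf (ε : ℝ) (hε : 0 < ε) : f ∈ C ⟨ε, hε⟩ := mem_iInter.1 hf _
  refine mem_sub.2 ⟨f, ?_, f - v, fun w hw => le_of_forall_pos_le_add fun ε hε => ?_,
    sub_sub_cancel f v⟩
  · rw [← hA.isClosed.closure_eq, Metric.closure_eq_iInter_cthickening]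
    exact mem_iInter₂.2 fun ε hε => (hf ε hε).1
  · exact (zero_add ε).symm ▸ (hf ε hε).2 w hw

end RelaxedVelocities

section OneSidedSlopes

variable {E : Type*} [NormedAddCommGroup E] [NormedSpace ℝ E]

lemma tendsto_neg_slope_zero_left {z : ℝ → E} {t : ℝ} {v : E} (hz : HasDerivAt z v t) :
    Tendsto (fun s => (-s)⁻¹ • (z (t + s) - z t)) (𝓝[<] 0) (𝓝 (-v)) := by
  simpa only [inv_neg, neg_smul] using hz.tendsto_slope_zero_left.neg

lemma tendsto_slope_of_lipschitzOnWith {ι G : Type*} [NormedAddCommGroup G] [NormedSpace ℝ G]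
    {f : E → G} {p h : E} {a : G} {C : NNReal} {W : Set E} (hf : LipschitzOnWith C f W)
    (hW : W ∈ 𝓝 p) (hdir : Tendsto (fun t : ℝ => t⁻¹ • (f (p + t • h) - f p)) (𝓝[>] 0) (𝓝 a))
    {l : Filter ι} {s : ι → ℝ} {u : ι → E} (hs : Tendsto s l (𝓝[>] 0))
    (hu : Tendsto (fun i => (s i)⁻¹ • (u i - p)) l (𝓝 h)) :
    Tendsto (fun i => (s i)⁻¹ • (f (u i) - f p)) l (𝓝 a) := by
  have hs_pos : ∀ᶠ i in l, 0 < s i := hs.eventually self_mem_nhdsWithin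
  have hs_zero : Tendsto s l (𝓝 0) := hs.mono_right nhdsWithin_le_nhds
  have huW : ∀ᶠ i in l, u i ∈ W := by
    have hlim := (hs_zero.smul hu).add_const p
    rw [zero_smul, zero_add] at hlim
    filter_upwards [hs_pos, hlim.eventually hW] with i hi hiW
    rwa [smul_inv_smul₀ hi.ne', sub_add_cancel] at hiW
  have hrayW : ∀ᶠ i in l, p + s i • h ∈ W := by
    have hlim := (hs_zero.smul_const h).const_add p
    rw [zero_smul, add_zero] at hlim
    exact hlim.eventually hW
  have hbound : Tendsto (fun i => C * ‖(s i)⁻¹ • (u i - p) - h‖) l (𝓝 0) := by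
    simpa only [sub_self, norm_zero, mul_zero] using ((hu.sub_const h).norm).const_mul (C : ℝ)
  refine (tendsto_iff_of_dist (squeeze_zero' (.of_forall fun _ => dist_nonneg) ?_ hbound)).1
    (hdir.comp hs)
  filter_upwards [hs_pos, huW, hrayW] with i hi huW hrayW
  have hdir_eq : (s i)⁻¹ • (u i - p) - h = (s i)⁻¹ • (u i - (p + s i • h)) := by
    rw [← sub_sub, smul_sub _ _ (s i • h), inv_smul_smul₀ hi.ne']
  rw [dist_comm, dist_eq_norm, Function.comp_apply, ← smul_sub, sub_sub_sub_cancel_right, hdir_eq,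
    norm_smul, norm_smul, mul_left_comm]
  exact mul_le_mul_of_nonneg_left (hf.norm_sub_le huW hrayW) (norm_nonneg _)

end OneSidedSlopes

section ProjectedField

open scoped Pointwise

variable {d : ℕ} {K : Set (Eucl d)} {F : Eucl d → Set (Eucl d)} {V : Eucl d → ℝ}
  {p q u v : Eucl d} {z : ℝ → Eucl d} {t : ℝ}

lemma inner_nonpos_of_mem_convexTangentCone (hq : q ∈ epsNormalSet K 0 p)
    (hu : u ∈ convexTangentCone K p) : inner ℝ q u ≤ 0 := by
  refine closure_minimal ?_ (isClosed_le (innerSL ℝ q).continuous continuous_const) hu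
  rintro u ⟨ε, hε, hu⟩
  have h := hq _ hu
  rw [add_sub_cancel_left, real_inner_smul_right] at h
  exact nonpos_of_mul_nonpos_right h hε

lemma mem_convexTangentCone_of_tendsto {ι : Type*} {l : Filter ι} [NeBot l] {s : ι → ℝ}
    {w : ι → Eucl d} (hs : ∀ᶠ i in l, 0 < s i) (hw : ∀ i, w i ∈ K)
    (hu : Tendsto (fun i => (s i)⁻¹ • (w i - p)) l (𝓝 u)) : u ∈ convexTangentCone K p := by
  refine mem_closure_of_tendsto hu (hs.mono fun i hi => ⟨s i, hi, ?_⟩)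
  rw [smul_inv_smul₀ hi.ne', add_sub_cancel]
  exact hw i

/-- The normal part of the velocity is orthogonal to it, since both the velocity and its opposite
are tangent. -/
lemma mem_projField_of_hasDerivAt (hzK : ∀ s, z s ∈ K) (hz : HasDerivAt z v t)
    (hv : v ∈ F (z t) - epsNormalSet K 0 (z t)) : v ∈ projField K F (z t) := by
  obtain ⟨f, hf, q, hq, rfl⟩ := hv
  have hv : f - q ∈ convexTangentCone K (z t) :=
    mem_convexTangentCone_of_tendsto (eventually_mem_nhdsWithin (s := Ioi 0)) (fun _ => hzK _)
      hz.tendsto_slope_zero_right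
  have hv_neg : -(f - q) ∈ convexTangentCone K (z t) :=
    mem_convexTangentCone_of_tendsto (l := 𝓝[<] 0)
      (eventually_mem_nhdsWithin.mono fun _ => neg_pos.2) (fun _ => hzK _)
      (tendsto_neg_slope_zero_left hz)
  have horth : inner ℝ q (f - q) = 0 := by
    have h := inner_nonpos_of_mem_convexTangentCone hq hv_neg
    rw [inner_neg_right, neg_nonpos] at h
    exact (inner_nonpos_of_mem_convexTangentCone hq hv).antisymm h
  refine ⟨hv, f, hf, fun u hu => ?_⟩
  have hexpand : ‖f - u‖ ^ 2 = ‖q‖ ^ 2 - 2 * inner ℝ q u + ‖f - q - u‖ ^ 2 := by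
    rw [show f - u = q + (f - q - u) by abel, norm_add_sq_real, inner_sub_right, horth]
    ring
  rw [dist_eq_norm, dist_eq_norm, sub_sub_cancel]
  refine le_of_sq_le_sq ?_ (norm_nonneg _)
  linarith [inner_nonpos_of_mem_convexTangentCone hq hu, sq_nonneg ‖f - q - u‖]

lemma ClarkeRegularAt.tendsto_slope (hreg : ClarkeRegularAt V p) {C : NNReal}
    {W : Set (Eucl d)} (hV : LipschitzOnWith C V W) (hW : W ∈ 𝓝 p) {ι : Type*} {l : Filter ι}
    {s : ι → ℝ} {w : ι → Eucl d} (hs : Tendsto s l (𝓝[>] 0))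
    (hw : Tendsto (fun i => (s i)⁻¹ • (w i - p)) l (𝓝 u)) :
    Tendsto (fun i => (s i)⁻¹ • (V (w i) - V p)) l (𝓝 (clarkeDeriv V p u)) :=
  tendsto_slope_of_lipschitzOnWith hV hW
    (by simpa only [smul_eq_mul, inv_mul_eq_div] using hreg u) hs hw

lemma mem_lieDeriv_of_hasDerivAt {G : Eucl d → Set (Eucl d)} {C : NNReal} {W : Set (Eucl d)}
    {D : ℝ} (hV : LipschitzOnWith C V W) (hW : W ∈ 𝓝 (z t)) (hreg : ClarkeRegularAt V (z t))
    (hz : HasDerivAt z v t) (hD : HasDerivAt (fun s => V (z s)) D t) (hv : v ∈ G (z t)) :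
    D ∈ lieDeriv G V (z t) := by
  have hright : clarkeDeriv V (z t) v = D :=
    tendsto_nhds_unique (hreg.tendsto_slope hV hW tendsto_id hz.tendsto_slope_zero_right)
      hD.tendsto_slope_zero_right
  have hneg : Tendsto (fun s : ℝ => -s) (𝓝[<] 0) (𝓝[>] 0) := by
    simpa only [neg_zero] using tendsto_neg_nhdsLT (a := (0 : ℝ))
  have hleft : clarkeDeriv V (z t) (-v) = -D :=
    tendsto_nhds_unique (hreg.tendsto_slope hV hW hneg (tendsto_neg_slope_zero_left hz))
      (tendsto_neg_slope_zero_left hD)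
  refine ⟨v, hv, fun w hw => (hright ▸ hw v).antisymm ?_⟩
  have h := hw (-v)
  rwa [hleft, inner_neg_left, neg_le_neg_iff] at h

end ProjectedField

section Decrease

lemma sub_le_of_ae_deriv_le {φ : ℝ → ℝ} {a b c : ℝ} (hab : a ≤ b)
    (hφ : AbsolutelyContinuousOnInterval φ a b)
    (hderiv : ∀ᵐ t, t ∈ Icc a b → deriv φ t ≤ c) : φ b - φ a ≤ c * (b - a) := by
  have hle : ∫ t in a..b, deriv φ t ≤ ∫ _ in a..b, c :=
    intervalIntegral.integral_mono_ae_restrict hab hφ.intervalIntegrable_deriv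
      intervalIntegrable_const ((MeasureTheory.ae_restrict_iff' measurableSet_Icc).2 hderiv)
  rwa [hφ.integral_deriv_eq_sub, intervalIntegral.integral_const, smul_eq_mul, mul_comm] at hle

lemma eventually_lt_of_forall_hasDerivAt_le {E : Type*} [NormedAddCommGroup E] [NormedSpace ℝ E]
    [FiniteDimensional ℝ E] {V U : E → ℝ} {K W : Set E} {z : ℝ → E} {C C' : NNReal}
    (hzK : ∀ t, z t ∈ K) (hz : LipschitzWith C z) (hV : LipschitzOnWith C' V W)
    (hW : W ∈ 𝓝 (z 0)) (hU : UpperSemicontinuousWithinAt U K (z 0))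
    (hderiv : ∀ t, DifferentiableAt ℝ z t → ∀ D, HasDerivAt (fun s => V (z s)) D t → D ≤ U (z t))
    (h0 : U (z 0) < 0) : ∀ᶠ t in 𝓝[>] 0, V (z t) < V (z 0) := by
  obtain ⟨c, hUc, hc⟩ := exists_between h0
  have hz_cont : Tendsto z (𝓝 0) (𝓝[K] (z 0)) :=
    tendsto_nhdsWithin_iff.2 ⟨hz.continuous.continuousAt, .of_forall hzK⟩
  have hnear : ∀ᶠ t in 𝓝 0, z t ∈ W ∧ U (z t) < c :=
    hz_cont.eventually (inter_mem (nhdsWithin_le_nhds hW) (hU c hUc))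
  have hIcc : Tendsto (fun t : ℝ => Icc 0 t) (𝓝[>] 0) (𝓝 0).smallSets :=
    tendsto_const_nhds.Icc nhdsWithin_le_nhds
  filter_upwards [hIcc.eventually (eventually_smallSets_forall.2 hnear), self_mem_nhdsWithin]
    with t ht (htpos : 0 < t)
  have hlip : LipschitzOnWith (C' * C) (fun s => V (z s)) (uIcc 0 t) := by
    rw [uIcc_of_le htpos.le]
    exact hV.comp hz.lipschitzOnWith fun s hs => (ht s hs).1
  have hac := hlip.absolutelyContinuousOnInterval
  have hdecr : V (z t) - V (z 0) ≤ c * (t - 0) := by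
    refine sub_le_of_ae_deriv_le htpos.le hac ?_
    filter_upwards [hz.ae_differentiableAt, hac.ae_differentiableAt] with s hzs hVzs hs
    have hVzs := hVzs (uIcc_of_le htpos.le ▸ hs)
    exact (hderiv s hzs _ hVzs.hasDerivAt).trans (ht s hs).2.le
  rw [sub_zero] at hdecr
  exact sub_neg.1 (hdecr.trans_lt (mul_neg_of_neg_of_pos hc htpos))

end Decrease

/-- Near each point `p` of `K` the velocities `v` of the sequence `x` are eventually relaxed
velocities of `F p`, with arbitrarily small relaxation. The velocity `v k` is attached to
`x (k + 1)`, the point at which its normal part is taken. -/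
def HasProjectedVelocities {d : ℕ} (K : Set (Eucl d)) (F : Eucl d → Set (Eucl d))
    (x v : ℕ → Eucl d) : Prop :=
  ∀ p ∈ K, ∀ ε > 0, ∃ W ∈ 𝓝 p, ∀ᶠ k in atTop,
    x (k + 1) ∈ W → v k ∈ relaxedVelocities K (F p) ε p

section LimitVelocities

variable {d : ℕ} {X K : Set (Eucl d)} {F : Eucl d → Set (Eucl d)} {V U : Eucl d → ℝ}
  {τ : ℕ → ℝ} {x v ζ : ℕ → Eucl d} {M : ℝ}

lemma IsDrivenBy.mem_projField_of_hasDerivAt {l : Filter ℕ} [NeBot l] {z : ℝ → Eucl d}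
    {t : ℝ} {w : Eucl d} (h : IsDrivenBy τ x v ζ M) (hv : HasProjectedVelocities K F x v)
    (hl : l ≤ atTop) (hz : IsLimitTrajectory τ x l z) (hzK : ∀ s, z s ∈ K)
    (hF_convex : ∀ p ∈ K, Convex ℝ (F p)) (hF_compact : ∀ p ∈ K, IsCompact (F p))
    (hw : HasDerivAt z w t) : w ∈ projField K F (z t) := by
  refine _root_.mem_projField_of_hasDerivAt hzK hw
    (mem_sub_epsNormalSet_zero (hF_compact _ (hzK t)) fun ε hε => ?_)
  obtain ⟨W, hW, hvW⟩ := hv _ (hzK t) ε hε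
  exact h.hasDerivAt_mem hl hz hw (convex_relaxedVelocities (hF_convex _ (hzK t)))
    (isClosed_relaxedVelocities (hF_compact _ (hzK t))) hW hvW

lemma IsDrivenBy.decreasesOff (h : IsDrivenBy τ x v ζ M) (hv : HasProjectedVelocities K F x v)
    (hK : IsClosed K) (hx : ∀ᶠ k in atTop, x k ∈ K) (hX : IsOpen X) (hKX : K ⊆ X)
    (hF_convex : ∀ p ∈ K, Convex ℝ (F p)) (hF_compact : ∀ p ∈ K, IsCompact (F p))
    (hV_lip : LocallyLipschitzOn X V) (hV_reg : ∀ p ∈ K, ClarkeRegularAt V p)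
    (hU : UpperSemicontinuousOn U K)
    (hLie : ∀ p ∈ K, ∀ a ∈ lieDeriv (projField K F) V p, a ≤ U p) (hU_nonpos : ∀ p ∈ K, U p ≤ 0) :
    DecreasesOff τ x V {p | p ∈ X ∧ U p = 0} := by
  have hV_lip_nhds (p : Eucl d) (hp : p ∈ K) : ∃ C, ∃ W ∈ 𝓝 p, LipschitzOnWith C V W :=
    hX.nhdsWithin_eq (hKX hp) ▸ hV_lip (hKX hp)
  intro l z hl hz hzS
  have hzK (t : ℝ) : z t ∈ K := hK.mem_of_mapClusterPt (hz.mapClusterPt h.clock hl t) hx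
  obtain ⟨C, W, hW, hVW⟩ := hV_lip_nhds _ (hzK 0)
  have hU_neg : U (z 0) < 0 := (hU_nonpos _ (hzK 0)).lt_of_ne fun h0 => hzS ⟨hKX (hzK 0), h0⟩
  refine (eventually_lt_of_forall_hasDerivAt_le hzK (h.lipschitzWith hl hz) hVW hW
    (hU _ (hzK 0)) (fun t hzt D hD => hLie _ (hzK t) D ?_) hU_neg).frequently
  obtain ⟨C, W, hW, hVW⟩ := hV_lip_nhds _ (hzK t)
  exact mem_lieDeriv_of_hasDerivAt hVW hW (hV_reg _ (hzK t)) hzt.hasDerivAt hD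
    (h.mem_projField_of_hasDerivAt hv hl hz hzK hF_convex hF_compact hzt.hasDerivAt)

end LimitVelocities

lemma sub_mem_epsNormalSet_of_forall_dist_le {E : Type*} [NormedAddCommGroup E]
    [InnerProductSpace ℝ E] {K : Set E} {a p : E} (hK : Convex ℝ K) (hp : p ∈ K)
    (hmin : ∀ z ∈ K, dist a p ≤ dist a z) : a - p ∈ epsNormalSet K 0 p := by
  have : Nonempty K := ⟨p, hp⟩
  refine (norm_eq_iInf_iff_real_inner_le_zero hK hp).1 (le_antisymm (le_ciInf fun w => ?_) ?_)
  · simpa only [dist_eq_norm] using hmin w w.2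
  · exact ciInf_le (f := fun w : K => ‖a - w‖) ⟨0, forall_mem_range.2 fun _ => norm_nonneg _⟩
      ⟨p, hp⟩

section Discretization

variable {d : ℕ} {X K : Set (Eucl d)} {F : Eucl d → Set (Eucl d)}
  {x y : ℕ → Eucl d} {γ : ℕ → ℝ} {η e r : ℕ → Eucl d}

lemma exists_normal_of_mem_projSet {A : Set (Eucl d)} {a b p : Eucl d} {c : ℝ}
    (hK : Convex ℝ K) (hc : 0 < c) (hp : p ∈ projSet K ((fun f => a + c • (f + b)) '' A)) :
    ∃ f ∈ A, ∃ q ∈ epsNormalSet K 0 p,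
      p - a = c • (f + b - q) ∧ (a ∈ K → ‖q‖ ≤ ‖f + b‖) := by
  obtain ⟨hpK, _, ⟨f, hf, rfl⟩, hmin⟩ := hp
  refine ⟨f, hf, c⁻¹ • (a + c • (f + b) - p), fun w hw => ?_, ?_, fun ha => ?_⟩
  · rw [real_inner_smul_left]
    exact mul_nonpos_of_nonneg_of_nonpos (inv_nonneg.2 hc.le)
      (sub_mem_epsNormalSet_of_forall_dist_le hK hpK hmin w hw)
  · rw [smul_sub, smul_inv_smul₀ hc.ne']
    abel
  · rw [norm_smul, norm_inv, Real.norm_of_nonneg hc.le, inv_mul_le_iff₀ hc]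
    simpa only [dist_eq_norm, add_sub_cancel_left, norm_smul, Real.norm_of_nonneg hc.le]
      using hmin a ha

lemma StepAssumption.isClock (hγ : StepAssumption γ) :
    IsClock fun n => ∑ k ∈ Finset.Icc 1 n, γ k where
  strictMono := strictMono_nat_of_lt_succ fun n => by
    rw [Finset.sum_Icc_succ_top n.succ_pos]
    exact lt_add_of_pos_right _ (hγ.pos _ n.succ_pos)
  tendsto_time := hγ.sum_diverges
  tendsto_increment := by
    simpa only [Finset.sum_Icc_succ_top (Nat.succ_pos _), add_sub_cancel_left]
      using (tendsto_add_atTop_iff_nat 1).2 hγ.tendsto_zero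

lemma NoiseAssumption.exists_eventually_norm_le (hη : NoiseAssumption γ η e r)
    (he : ∃ C : ℝ, ∀ k, 1 ≤ k → ‖e k‖ ≤ C) : ∃ C, ∀ᶠ k in atTop, ‖η k‖ ≤ C := by
  obtain ⟨C, hC⟩ := he
  refine ⟨C + 1, ?_⟩
  filter_upwards [eventually_ge_atTop 1, hη.tendsto_zero.eventually_le_const one_pos] with k hk hr
  rw [hη.decomp k hk]
  exact norm_add_le_of_le (hC k hk) hr

lemma IsPPAD.eventually_mem (hx : IsPPAD X K F x y γ η) : ∀ᶠ k in atTop, x k ∈ K :=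
  (eventually_ge_atTop 1).mono fun k hk => Nat.sub_add_cancel hk ▸ (hx.step (k - 1)).1

namespace FieldAssumption

lemma exists_eventually_norm_le (hF : FieldAssumption X F) (hK : IsCompact K) (hKX : K ⊆ X)
    (hx : ∀ᶠ k in atTop, x k ∈ K) (hxy : Tendsto (fun k => ‖x k - y k‖) atTop (𝓝 0)) :
    ∃ B, ∀ᶠ k in atTop, ∀ f ∈ F (y k), ‖f‖ ≤ B := by
  obtain ⟨δ, hδ, hδX⟩ := hK.exists_cthickening_subset_open hF.isOpen hKX
  obtain ⟨B, hB⟩ := (hF.locallyBounded _ hK.cthickening hδX).exists_norm_le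
  refine ⟨B, ?_⟩
  filter_upwards [hx, hxy.eventually_le_const hδ] with k hxk hdist f hf
  rw [← dist_eq_norm, dist_comm] at hdist
  exact hB f (mem_biUnion (Metric.mem_cthickening_of_dist_le _ _ _ _ hxk hdist) hf)

lemma exists_eventually_subset_thickening (hF : FieldAssumption X F) {p : Eucl d} (hp : p ∈ X)
    (hxy : Tendsto (fun k => ‖x k - y k‖) atTop (𝓝 0)) {ε : ℝ} (hε : 0 < ε) :
    ∃ W ∈ 𝓝 p, ∀ᶠ k in atTop, x k ∈ W → F (y k) ⊆ Metric.thickening ε (F p) := by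
  have hnhds := upperHemicontinuousOn_iff_forall_isOpen.1 hF.upperHemicontinuousOn p hp _
    Metric.isOpen_thickening (Metric.self_subset_thickening hε (F p))
  rw [hF.isOpen.nhdsWithin_eq hp] at hnhds
  obtain ⟨δ, hδ, hball⟩ := Metric.eventually_nhds_iff_ball.1 hnhds
  refine ⟨Metric.ball p (δ / 2), Metric.ball_mem_nhds _ (half_pos hδ), ?_⟩
  filter_upwards [hxy.eventually_lt_const (half_pos hδ)] with k hdist hxk
  rw [← dist_eq_norm, dist_comm] at hdist
  exact hball _ (Metric.mem_ball.2 ((dist_triangle_right _ _ _).trans_lt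
    ((add_lt_add hdist (Metric.mem_ball'.1 hxk)).trans_eq (add_halves δ))))

lemma hasProjectedVelocities {f q : ℕ → Eucl d} {R : ℝ} (hF : FieldAssumption X F) (hKX : K ⊆ X)
    (hxy : Tendsto (fun k => ‖x k - y k‖) atTop (𝓝 0)) (hf : ∀ k, f k ∈ F (y (k + 1)))
    (hr : Tendsto (fun k => ‖r k‖) atTop (𝓝 0)) (hq : ∀ k, q k ∈ epsNormalSet K 0 (x (k + 1)))
    (hq_norm : ∀ᶠ k in atTop, ‖q k‖ ≤ R) :
    HasProjectedVelocities K F x fun k => f k + r (k + 1) - q k := by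
  intro p hp ε hε
  have hsmall : ∀ᶠ z in 𝓝 p, R * dist z p ≤ ε := by
    have hlim : ContinuousAt (fun z => R * dist z p) p := by fun_prop
    exact hlim.eventually_le_const (by simpa only [dist_self, mul_zero] using hε)
  obtain ⟨W, hW, hFW⟩ := hF.exists_eventually_subset_thickening (hKX hp) hxy (half_pos hε)
  refine ⟨_, inter_mem hW hsmall, ?_⟩
  filter_upwards [(tendsto_add_atTop_nat 1).eventually hFW, hq_norm,
    ((tendsto_add_atTop_iff_nat 1).2 hr).eventually_lt_const (half_pos hε)]
    with k hFk hqk hrk ⟨hxW, hxR⟩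
  obtain ⟨a, ha, hfa⟩ := Metric.mem_thickening_iff.1 (hFk hxW (hf k))
  refine sub_mem_sub (Metric.mem_cthickening_of_dist_le _ a _ _ ha ?_)
    (mem_epsNormalSet_of_norm_mul_dist_le (hq k)
      ((mul_le_mul_of_nonneg_right hqk dist_nonneg).trans hxR))
  have hdist_add : dist (f k + r (k + 1)) (f k) = ‖r (k + 1)‖ := dist_self_add_left _ _
  linarith [dist_triangle (f k + r (k + 1)) (f k) a]

end FieldAssumption

theorem IsPPAD.exists_isDrivenBy (hx : IsPPAD X K F x y γ η) (hK_convex : Convex ℝ K)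
    (hK_compact : IsCompact K) (hKX : K ⊆ X) (hF : FieldAssumption X F) (hγ : StepAssumption γ)
    (hη : NoiseAssumption γ η e r) (hxy : Tendsto (fun k => ‖x k - y k‖) atTop (𝓝 0))
    (he : ∃ C : ℝ, ∀ k, 1 ≤ k → ‖e k‖ ≤ C) :
    ∃ τ v ζ M, IsDrivenBy τ x v ζ M ∧ HasProjectedVelocities K F x v := by
  choose f hf q hq hstep hq_le using fun k =>
    exists_normal_of_mem_projSet hK_convex (hγ.pos _ k.succ_pos) (hx.step k)
  obtain ⟨B, hB⟩ := hF.exists_eventually_norm_le hK_compact hKX hx.eventually_mem hxy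
  obtain ⟨C, hC⟩ := hη.exists_eventually_norm_le he
  have hf_norm : ∀ᶠ k in atTop, ‖f k‖ ≤ B :=
    ((tendsto_add_atTop_nat 1).eventually hB).mono fun k hk => hk _ (hf k)
  have hr_norm : ∀ᶠ k in atTop, ‖r (k + 1)‖ ≤ 1 :=
    ((tendsto_add_atTop_iff_nat 1).2 hη.tendsto_zero).eventually_le_const one_pos
  have hq_norm : ∀ᶠ k in atTop, ‖q k‖ ≤ B + C := by
    filter_upwards [hx.eventually_mem, hf_norm, (tendsto_add_atTop_nat 1).eventually hC]
      with k hxk hfk hηk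
    exact (hq_le k hxk).trans (norm_add_le_of_le hfk hηk)
  refine ⟨_, fun k => f k + r (k + 1) - q k, fun n => ∑ k ∈ Finset.Icc 1 n, γ k • e k,
    B + 1 + (B + C), ⟨hγ.isClock, fun k => ?_, ?_, hη.series_converges⟩,
    hF.hasProjectedVelocities hKX hxy hf hη.tendsto_zero hq hq_norm⟩
  · rw [hstep, hη.decomp _ k.succ_pos, Finset.sum_Icc_succ_top k.succ_pos,
      Finset.sum_Icc_succ_top k.succ_pos, add_sub_cancel_left, add_sub_cancel_left, ← smul_add]
    congr 1
    abel
  · filter_upwards [hf_norm, hr_norm, hq_norm] with k hfk hrk hqk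
    exact norm_sub_le_of_le (norm_add_le_of_le hfk hrk) hqk

end Discretization

lemma limitPoints_eq_setOf_mapClusterPt {d : ℕ} (x : ℕ → Eucl d) :
    limitPoints x = {p | MapClusterPt p atTop x} := by
  ext p
  refine ⟨fun ⟨_, hφ, hlim⟩ => MapClusterPt.of_comp hφ.tendsto_atTop hlim.mapClusterPt,
    fun hp => ?_⟩
  obtain ⟨φ, hφ, hlim⟩ := hp.tendsto_subseq
  exact ⟨φ, hφ, hlim⟩

lemma isClosed_zeros_inter {α : Type*} [TopologicalSpace α] {X K : Set α} {U : α → ℝ}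
    (hK : IsClosed K) (hKX : K ⊆ X) (hU : UpperSemicontinuousOn U X)
    (hU_nonpos : ∀ p ∈ K, U p ≤ 0) : IsClosed ({p | p ∈ X ∧ U p = 0} ∩ K) := by
  obtain ⟨C, hC, heq⟩ := upperSemicontinuousOn_iff_preimage_Ici.1 (hU.mono hKX) 0
  convert hK.inter hC using 1
  rw [← heq]
  ext p
  exact ⟨fun ⟨⟨_, h0⟩, hp⟩ => ⟨hp, h0.ge⟩,
    fun ⟨hp, h0⟩ => ⟨⟨hKX hp, (hU_nonpos p hp).antisymm h0⟩, hp⟩⟩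

theorem mainTheorem4 {d : ℕ} (X K : Set (Eucl d)) (F : Eucl d → Set (Eucl d))
    (x y : ℕ → Eucl d) (γ : ℕ → ℝ) (η e r : ℕ → Eucl d)
    (hK_convex : Convex ℝ K) (hK_compact : IsCompact K) (hKX : K ⊆ X)
    (hF : FieldAssumption X F) (hγ : StepAssumption γ)
    (hη : NoiseAssumption γ η e r) (hy : ApproxAssumption X x y)
    (hx : IsPPAD X K F x y γ η)
    (he : ∃ C : ℝ, ∀ k, 1 ≤ k → ‖e k‖ ≤ C)
    (V U : Eucl d → ℝ)
    (hV_lip : LocallyLipschitzOn X V) (hV_reg : ∀ z ∈ X, ClarkeRegularAt V z)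
    (hU : UpperSemicontinuousOn U X)
    (hLie : ∀ z ∈ K, ∀ a ∈ lieDeriv (projField K F) V z, a ≤ U z)
    (hU_nonpos : ∀ z ∈ K, U z ≤ 0)
    (S : Set (Eucl d)) (hS : S = {z | z ∈ X ∧ U z = 0}) :
    (∃ a b : ℝ, a ≤ b ∧ V '' limitPoints x = Set.Icc a b ∧ Set.Icc a b ⊆ V '' (S ∩ K)) ∧
    (interior (V '' (S ∩ K)) = ∅ →
      (S ∩ K).Nonempty ∧ Tendsto (fun k => Metric.infDist (x k) (S ∩ K)) atTop (𝓝 0)) := by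
  subst hS
  obtain ⟨τ, v, ζ, M, hdriven, hv⟩ :=
    hx.exists_isDrivenBy hK_convex hK_compact hKX hF hγ hη hy.tendsto_zero he
  have hxK := hx.eventually_mem
  have hV := hV_lip.continuousOn.mono hKX
  have hS_closed := isClosed_zeros_inter hK_compact.isClosed hKX hU hU_nonpos
  have hdec := hdriven.decreasesOff hv hK_compact.isClosed hxK hF.isOpen hKX
    (fun p hp => hF.convex p (hKX hp)) (fun p hp => hF.isCompact p (hKX hp)) hV_lip
    (fun p hp => hV_reg p (hKX hp)) (hU.mono hKX) hLie hU_nonpos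
  rw [limitPoints_eq_setOf_mapClusterPt]
  refine ⟨hdriven.exists_image_mapClusterPt_eq_Icc hK_compact hxK hV hS_closed hdec, fun hint => ?_⟩
  have hmem (p : Eucl d) (hp : MapClusterPt p atTop x) : p ∈ {z | z ∈ X ∧ U z = 0} ∩ K :=
    ⟨hdriven.mem_of_mapClusterPt_of_interior_eq_empty hK_compact hxK hV hS_closed hdec hint hp,
      hK_compact.isClosed.mem_of_mapClusterPt hp hxK⟩
  obtain ⟨p, -, hp⟩ := hK_compact.exists_mapClusterPt (le_principal_iff.2 hxK)
  exact ⟨⟨p, hmem p hp⟩, tendsto_infDist_of_forall_mapClusterPt hK_compact hxK hmem⟩
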